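/- Let $D$ be an oriented knot diagram with $n\ge 1$ crossings and let $\pi$ be the group of the knot that it represents, with its Wirtinger presentation: one meridian generator $m_r$ for each of the $n$ arcs $r$ of $D$ (an arc runs from one undercrossing to the next) and, for each crossing with over strand $i$, incoming under strand $j$, outgoing under strand $k$ and sign $\sigma=\pm1$, the relation $m_jm_i^{\sigma}=m_i^{\sigma}m_k$. The variety of augmentations $A(D)\subset\mathbb C^{\binom n2}$ is the set of points $\varepsilon=(\varepsilon_{rs})$, indexed by unordered pairs of distinct arcs, such that, with $\varepsilon_{rr}=2$ and $\varepsilon_{sr}=\varepsilon_{rs}$, one has $\varepsilon_{lj}+\varepsilon_{lk}=\varepsilon_{li}\varepsilon_{ij}$ for all arcs $l$ and all crossings with over strand $i$ and under strands $j,k$. The rank of $\varepsilon$ is the rank of the matrix $[\varepsilon_{rs}]$. Put $\varepsilon(r,s,t)=\varepsilon_{rs}^2+\varepsilon_{rt}^2+\varepsilon_{st}^2-\varepsilon_{rs}\varepsilon_{rt}\varepsilon_{st}-2$. An $\varepsilon\in A(D)$ of rank three is called elliptic if $\varepsilon_{rs}\in[-2,2]\subset\mathbb R$ for all distinct arcs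 $r,s$ and $\varepsilon(r,s,t)\in[-2,2]$ for all distinct arcs $r,s,t$. Let $\varepsilon\in A(D)$ have rank three. Then there are arcs $a_1,a_2,a_3$ with $T:=\det[\varepsilon_{a_ia_j}]_{1\le i,j\le3}\neq0$. For every choice of such arcs and of a square root $\sigma$ of $T/2$ there is exactly one character $\chi=\mathfrak X(\varepsilon)$ of a trace-free representation $\pi\to\mathrm{SL}_2(\mathbb C)$ (one that sends meridians to matrices of trace $0$) such that $\chi(m_rm_s^{-1})=\varepsilon_{rs}$ for all $r\ne s$ and $-\chi(m_{a_1}m_{a_2}m_{a_3})=\sigma$. This $\mathfrak X(\varepsilon)$ is not the character of a representation into the binary-dihedral subgroup $S^1\cup S^1\mathbf j$ of $\mathrm{SU}(2)$, and $$\varepsilon\text{ is elliptic}\iff\mathfrak X(\varepsilon)\text{ is the character of a representation }\pi\to\mathrm{SU}(2).$$ Moreover, suppose that $\varepsilon$ is elliptic. Then there are arcs $p,q,r$ with $\varepsilon_{pq}\in(-2,2)$ and $\varepsilon(p,q,r)<2$. For all such arcs and each root $d$ of $d^2-\varepsilon_{pq}d+1=0$ put $a_l=\frac{\varepsilon_{ql}-\varepsilon_{pl}d}{\varepsilon_{pq}-2d}$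 for every arc $l$, $a=a_r$ and $\alpha=1-a(\varepsilon_{pr}-a)$. Then there are matrices of determinant one $$A_l=\begin{pmatrix}a_l&b_l\\c_l&\varepsilon_{pl}-a_l\end{pmatrix},\qquad c_l=a(\varepsilon_{pl}-a_l)-\varepsilon_{rl}+b_l-b_la(\varepsilon_{pr}-a)+(\varepsilon_{pr}-a)a_l,$$ and a square root $\beta$ of $\alpha$ such that, with $$T_\beta=\begin{pmatrix}0&\sqrt{-1}\,\beta^{-1}\\\sqrt{-1}\,\beta&0\end{pmatrix},\qquad P=\begin{pmatrix}\beta^{-1}&\beta^{-1}\\1&-1\end{pmatrix},$$ the assignment $m_l\mapsto P^{-1}(T_\beta A_l)P$ defines a representation $\pi\to\mathrm{SU}(2)$ with character $\mathfrak X(\varepsilon)$. -/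

import Mathlib

noncomputable section

/-- A signed Gauss code with `n` crossings. A passage `(c, true)` (resp. `(c, false)`) is the moment
at which one traverses the crossing `c` along its over (resp. under) strand. `next` sends a passage
to the following one along the orientation, and `sign c` is the sign of the crossing `c`. -/
structure GaussCode where
  n : ℕ
  next : Equiv.Perm (Fin n × Bool)
  sign : Fin n → ℤˣ

namespace GaussCode

/-- The state `(p, δ)` means: leaving passage `p` in direction `δ` (`1` along the orientation, `-1`
against it). Follow the edge to the passage at its other end and turn left there onto the other
strand. At a positive crossing the under strand crosses the over strand from right to left, at
a negative crossing from left to right. -/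
def faceStep (G : GaussCode) (x : (Fin G.n × Bool) × ℤˣ) : (Fin G.n × Bool) × ℤˣ :=
  let q := (G.next ^ (x.2 : ℤ)) x.1
  ((q.1, !q.2), x.2 * (if q.2 then 1 else -1) * G.sign q.1)

/-- The faces of the surface carrying the diagram: the orbits of `faceStep`. -/
def Face (G : GaussCode) : Type :=
  Quot fun x y : (Fin G.n × Bool) × ℤˣ => y = G.faceStep x

end GaussCode

/-- An oriented knot diagram on the sphere with at least one crossing: a signed Gauss code with
one component (all passages form a single cycle) and of genus zero
(Euler characteristic `n - 2n + #faces = 2`, which forces `n ≠ 0`). -/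
structure KnotDiagram extends GaussCode where
  one_component : next.IsCycleOn Set.univ
  planar : Nat.card toGaussCode.Face = n + 2

namespace KnotDiagram

/-- The components (arcs) of the diagram, from an undercrossing to the next one. The class of
a passage `p` is the arc containing the edge that leaves `p`; the edges before and after an
overpass lie on the same arc. -/
def Arc (D : KnotDiagram) : Type :=
  Quot fun p q : Fin D.n × Bool => q = D.next p ∧ q.2 = true

instance (D : KnotDiagram) : Finite D.Arc :=
  inferInstanceAs (Finite (Quot fun p q : Fin D.n × Bool => q = D.next p ∧ q.2 = true))

instance (D : KnotDiagram) : Fintype D.Arc := Fintype.ofFinite _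

/-- The overcrossing strand at a crossing. -/
def overArc (D : KnotDiagram) (c : Fin D.n) : D.Arc := Quot.mk _ (c, true)

/-- The undercrossing strand that arrives at a crossing. -/
def underIn (D : KnotDiagram) (c : Fin D.n) : D.Arc := Quot.mk _ (D.next.symm (c, false))

/-- The undercrossing strand that leaves a crossing. -/
def underOut (D : KnotDiagram) (c : Fin D.n) : D.Arc := Quot.mk _ (c, false)

/-! ### The knot group, its trace-free characters and its `SU(2)` characters -/

/-- The Wirtinger relators `m_j m_i^σ m_k⁻¹ m_i^{-σ}`, one for each crossing of sign `σ`, with over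
strand `i`, incoming under strand `j` and outgoing under strand `k`. -/
def wirtingerRels (D : KnotDiagram) : Set (FreeGroup D.Arc) :=
  Set.range fun c : Fin D.n =>
    FreeGroup.of (D.underIn c) * FreeGroup.of (D.overArc c) ^ (D.sign c : ℤ) *
      (FreeGroup.of (D.underOut c))⁻¹ * FreeGroup.of (D.overArc c) ^ (-(D.sign c : ℤ))

/-- The knot group, through the Wirtinger presentation. -/
abbrev KnotGroup (D : KnotDiagram) : Type := PresentedGroup D.wirtingerRels

/-- The meridian of an arc. -/
def meridian (D : KnotDiagram) (r : D.Arc) : D.KnotGroup := PresentedGroup.of r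

/-- The set of characters of trace-free representations of the knot group in `SL₂(ℂ)`. -/
def traceFreeCharacters (D : KnotDiagram) : Set (D.KnotGroup → ℂ) :=
  {χ | ∃ ρ : D.KnotGroup →* Matrix.SpecialLinearGroup (Fin 2) ℂ,
    (∀ r, Matrix.trace (ρ (D.meridian r) : Matrix (Fin 2) (Fin 2) ℂ) = 0) ∧
    ∀ g, χ g = Matrix.trace (ρ g : Matrix (Fin 2) (Fin 2) ℂ)}

/-- `χ` is the character of the representation `ρ` in `SU(2)`. -/
def IsCharacterOf (D : KnotDiagram) (χ : D.KnotGroup → ℂ)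
    (ρ : D.KnotGroup →* Matrix.specialUnitaryGroup (Fin 2) ℂ) : Prop :=
  ∀ g, χ g = Matrix.trace (ρ g : Matrix (Fin 2) (Fin 2) ℂ)

/-- `χ` is the character of a representation in `SU(2)`. -/
def IsSU2Character (D : KnotDiagram) (χ : D.KnotGroup → ℂ) : Prop :=
  ∃ ρ : D.KnotGroup →* Matrix.specialUnitaryGroup (Fin 2) ℂ, D.IsCharacterOf χ ρ

/-- `χ` is the character of a representation with image in the binary-dihedral subgroup
`S¹ ∪ S¹ j` of `SU(2)`, that is, by diagonal and anti-diagonal matrices. -/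
def IsBinaryDihedralCharacter (D : KnotDiagram) (χ : D.KnotGroup → ℂ) : Prop :=
  ∃ ρ : D.KnotGroup →* Matrix.specialUnitaryGroup (Fin 2) ℂ, D.IsCharacterOf χ ρ ∧
    ∀ g, ((ρ g : Matrix (Fin 2) (Fin 2) ℂ) 0 1 = 0 ∧ (ρ g : Matrix (Fin 2) (Fin 2) ℂ) 1 0 = 0) ∨
      ((ρ g : Matrix (Fin 2) (Fin 2) ℂ) 0 0 = 0 ∧ (ρ g : Matrix (Fin 2) (Fin 2) ℂ) 1 1 = 0)

/-! ### The variety of augmentations -/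

/-- Points of `ℂ^(n choose 2)`: one coordinate for each unordered pair of distinct arcs. -/
abbrev PairCoords (D : KnotDiagram) : Type := {e : Sym2 D.Arc // ¬ e.IsDiag} → ℂ

open Classical in
/-- The symmetric matrix `[ε_rs]`, with `ε_rr = 2`. -/
def cordMatrix (D : KnotDiagram) (ε : D.PairCoords) : Matrix D.Arc D.Arc ℂ :=
  Matrix.of fun r s => if h : s(r, s).IsDiag then 2 else ε ⟨s(r, s), h⟩

/-- The variety of augmentations `A(D)`. -/
def augVariety (D : KnotDiagram) : Set D.PairCoords :=
  {ε | ∀ (c : Fin D.n) (l : D.Arc),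
    D.cordMatrix ε l (D.underIn c) + D.cordMatrix ε l (D.underOut c)
      - D.cordMatrix ε l (D.overArc c) * D.cordMatrix ε (D.overArc c) (D.underIn c) = 0}

/-- The rank of an augmentation. -/
def augRank (D : KnotDiagram) (ε : D.PairCoords) : ℕ := (D.cordMatrix ε).rank

/-- `ε(r,s,t) = ε_rs² + ε_rt² + ε_st² - ε_rs ε_rt ε_st - 2`. -/
def triple (D : KnotDiagram) (ε : D.PairCoords) (r s t : D.Arc) : ℂ :=
  D.cordMatrix ε r s ^ 2 + D.cordMatrix ε r t ^ 2 + D.cordMatrix ε s t ^ 2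
    - D.cordMatrix ε r s * D.cordMatrix ε r t * D.cordMatrix ε s t - 2

/-- The bounds that define an elliptic augmentation (among those of rank three). -/
def IsElliptic (D : KnotDiagram) (ε : D.PairCoords) : Prop :=
  (∀ r s : D.Arc, r ≠ s → D.cordMatrix ε r s ∈ Complex.ofReal '' Set.Icc (-2) 2) ∧
  (∀ r s t : D.Arc, r ≠ s → r ≠ t → s ≠ t →
    D.triple ε r s t ∈ Complex.ofReal '' Set.Icc (-2) 2)

/-- The principal minor `T(a,a) = det [ε_{a_i a_j}]` of size three. -/
def minor (D : KnotDiagram) (ε : D.PairCoords) (a : Fin 3 → D.Arc) : ℂ :=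
  ((D.cordMatrix ε).submatrix a a).det

/-- `χ` is the trace-free character `𝔛(ε)` for the choice of a triple of arcs `a` and of a square
root `σ` of `T(a,a)/2`: its coordinates `x_rs = tr ρ(m_r m_s⁻¹)` are `ε_rs`, and its coordinate
`x_{a₁a₂a₃} = -tr ρ(m_{a₁} m_{a₂} m_{a₃})` is `σ`. -/
def IsFrakX (D : KnotDiagram) (ε : D.PairCoords) (a : Fin 3 → D.Arc) (σ : ℂ)
    (χ : D.KnotGroup → ℂ) : Prop :=
  χ ∈ D.traceFreeCharacters ∧
  (∀ r s : D.Arc, r ≠ s → χ (D.meridian r * (D.meridian s)⁻¹) = D.cordMatrix ε r s) ∧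
  -χ (D.meridian (a 0) * D.meridian (a 1) * D.meridian (a 2)) = σ

/-! ### The explicit matrices, for arcs `p, q, r` in the roles of `1, 2, 3` -/

/-- `ε_pq ∈ (-2,2)` and `ε(p,q,r) < 2`. -/
def IsGoodTriple (D : KnotDiagram) (ε : D.PairCoords) (p q r : D.Arc) : Prop :=
  D.cordMatrix ε p q ∈ Complex.ofReal '' Set.Ioo (-2) 2 ∧
  D.triple ε p q r ∈ Complex.ofReal '' Set.Iio 2

/-- `a_l = (ε_ql - ε_pl d) / (ε_pq - 2 d)`. -/
def aEntry (D : KnotDiagram) (ε : D.PairCoords) (p q : D.Arc) (d : ℂ) (l : D.Arc) : ℂ :=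
  (D.cordMatrix ε q l - D.cordMatrix ε p l * d) / (D.cordMatrix ε p q - 2 * d)

/-- `α = 1 - a (ε_pr - a)` with `a = a_r`. -/
def alpha (D : KnotDiagram) (ε : D.PairCoords) (p q r : D.Arc) (d : ℂ) : ℂ :=
  1 - D.aEntry ε p q d r * (D.cordMatrix ε p r - D.aEntry ε p q d r)

/-- The matrices `A_l` with rows `(a_l, b_l)` and `(c_l, ε_pl - a_l)`, where
`c_l = a (ε_pl - a_l) - ε_rl + b_l - b_l a (ε_pr - a) + (ε_pr - a) a_l` and `b_l` is such that
the determinant is `1`. -/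
def IsTraceFamily (D : KnotDiagram) (ε : D.PairCoords) (p q r : D.Arc) (d : ℂ)
    (A : D.Arc → Matrix (Fin 2) (Fin 2) ℂ) : Prop :=
  ∀ l, A l 0 0 = D.aEntry ε p q d l ∧
    A l 1 1 = D.cordMatrix ε p l - D.aEntry ε p q d l ∧
    A l 1 0 = D.aEntry ε p q d r * (D.cordMatrix ε p l - D.aEntry ε p q d l)
      - D.cordMatrix ε r l + A l 0 1
      - A l 0 1 * D.aEntry ε p q d r * (D.cordMatrix ε p r - D.aEntry ε p q d r)
      + (D.cordMatrix ε p r - D.aEntry ε p q d r) * D.aEntry ε p q d l ∧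
    (A l).det = 1

end KnotDiagram

/-- The trace-free matrix `T`, in terms of a square root `β` of `α`. -/
def matrixT (β : ℂ) : Matrix (Fin 2) (Fin 2) ℂ :=
  !![0, Complex.I * β⁻¹; Complex.I * β, 0]

/-- The matrix `P` whose columns are the eigenvectors `(β⁻¹, 1)` and `(β⁻¹, -1)` of `T`. -/
def matrixP (β : ℂ) : Matrix (Fin 2) (Fin 2) ℂ :=
  !![β⁻¹, β⁻¹; 1, -1]

end

/-! Trace-free matrices in `M₂(ℂ)` are vectors of `ℂ³`, multiplied by the quaternion rule: minus the
dot product plus the cross product. Those of determinant one are the unit vectors, and conjugation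
by one is the half turn about it. Hence `tr(m_r m_s⁻¹) = 2 u_r·u_s` and `-tr(m₁m₂m₃) = 2
det(u₁,u₂,u₃)`. A symmetric `[ε_rs]` of rank three with diagonal 2 is twice the Gram matrix of unit
vectors spanning `ℂ³` (`exists_isVectorModel`). The augmentation equations, paired with a basis, say
that `u_k` is the half-turn image of `u_j` about `u_i`, which is the Wirtinger relation
(`IsVectorModel.exists_hom`). Two models whose bases have the same determinant differ by a rotation,
which extends to a trace-preserving automorphism of `M₂(ℂ)`, so the character is unique
(`IsVectorModel.trace_eq`); the root `σ` fixes that determinant. `SU(2)` corresponds to real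
vectors. Real models satisfy the elliptic bounds by Cauchy–Schwarz and `T = 8 det²`; conversely,
those bounds make Gram–Schmidt on `u_p, u_q, u_r` real, and its coordinates are the explicit
matrices (`IsGoodTriple.exists_explicit`). -/

noncomputable section

open Matrix

/-! ### Symmetric matrices of a given rank -/

namespace Matrix

variable {ι K : Type*} [Field K] {k : ℕ}

/-- If the rows `a i` span the row space of a symmetric matrix, then the matrix is determined by its
principal submatrix on `a`. -/
theorem IsSymm.exists_eq_mul_submatrix_mul {M : Matrix ι ι K} (hM : M.IsSymm) (a : Fin k → ι)
    (ha : ∀ l, M l ∈ Submodule.span K (Set.range fun i => M (a i))) :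
    ∃ C : Matrix ι (Fin k) K, M.submatrix id a = C * M.submatrix a a ∧
      M = C * M.submatrix a a * Cᵀ := by
  have h : ∀ l, ∃ c : Fin k → K, ∑ i, c i • M (a i) = M l := fun l =>
    (Submodule.mem_span_range_iff_exists_fun K).1 (ha l)
  choose C hC using h
  have h1 : M = of C * M.submatrix a id := by
    ext l m
    rw [← hC l]
    simp [mul_apply]
  have h2 : M.submatrix id a = of C * M.submatrix a a := by
    conv_lhs => rw [h1]
    rfl
  refine ⟨of C, h2, ?_⟩
  -- Symmetry lets the coefficients that express the rows also express the columns.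
  have h3 : M = (of C * M.submatrix a id)ᵀ := by rw [← h1, hM.eq]
  rw [transpose_mul, transpose_submatrix, hM.eq, h2] at h3
  exact h3

/-- A symmetric matrix of rank `k` has a nonzero principal minor of size `k`. -/
theorem IsSymm.exists_det_submatrix_ne_zero [Fintype ι] {M : Matrix ι ι K} (hM : M.IsSymm)
    (hk : M.rank = k) : ∃ a : Fin k → ι, (M.submatrix a a).det ≠ 0 := by
  subst hk
  rw [rank_eq_finrank_span_row]
  obtain ⟨f, hf, hspan, -⟩ := Submodule.exists_fun_fin_finrank_span_eq K (Set.range M.row)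
  choose a ha using hf
  refine ⟨a, fun hdet => ?_⟩
  obtain ⟨C, -, hC⟩ := hM.exists_eq_mul_submatrix_mul a fun l => by
    have : (fun i => M (a i)) = f := funext ha
    rw [this, hspan]
    exact Submodule.subset_span ⟨l, rfl⟩
  -- The factorization through the `k` by `k` submatrix forces the latter to have full rank.
  have hle : M.rank ≤ (M.submatrix a a).rank := by
    conv_lhs => rw [hC]
    exact (rank_mul_le_left _ _).trans (rank_mul_le_right _ _)
  have hge : (M.submatrix a a).rank ≤ M.rank := by
    rw [rank_eq_finrank_span_row M]
    simpa using rank_le_card_height (M.submatrix a a)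
  have hli : LinearIndependent K (M.submatrix a a).row := by
    rw [linearIndependent_iff_card_eq_finrank_span]
    exact (Fintype.card_fin _).trans ((rank_eq_finrank_span_row M).symm.trans
      ((le_antisymm hle hge).trans (rank_eq_finrank_span_row _)))
  exact ((isUnit_iff_isUnit_det _).1 (linearIndependent_rows_iff_isUnit.1 hli)).ne_zero hdet

/-- The chosen rows are independent even after restriction to the columns `a`, so by dimension they
span the row space. -/
theorem row_mem_span_of_det_submatrix_ne_zero [Fintype ι] {M : Matrix ι ι K} (hk : M.rank = k)
    {a : Fin k → ι} (ha : (M.submatrix a a).det ≠ 0) (l : ι) :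
    M l ∈ Submodule.span K (Set.range fun i => M (a i)) := by
  have hli : LinearIndependent K fun i => M (a i) := by
    have h : LinearIndependent K (M.submatrix a a).row :=
      linearIndependent_rows_iff_isUnit.2 ((isUnit_iff_isUnit_det _).2 (isUnit_iff_ne_zero.2 ha))
    exact LinearIndependent.of_comp (LinearMap.funLeft K K a) h
  have hle : Submodule.span K (Set.range fun i => M (a i)) ≤ Submodule.span K (Set.range M.row) :=
    Submodule.span_mono (by rintro _ ⟨i, rfl⟩; exact ⟨a i, rfl⟩)
  have heq := Submodule.eq_of_le_of_finrank_le hle (by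
    rw [← rank_eq_finrank_span_row, hk, finrank_span_eq_card hli, Fintype.card_fin])
  rw [heq]
  exact Submodule.subset_span ⟨l, rfl⟩

/-- A nondegenerate complex symmetric matrix is a Gram matrix. -/
theorem IsSymm.exists_eq_mul_transpose [Fintype ι] [DecidableEq ι] {N : Matrix ι ι ℂ}
    (hN : N.IsSymm) (h : N.det ≠ 0) : ∃ V : Matrix ι ι ℂ, N = V * Vᵀ := by
  have key : ∀ N : Matrix ι ι ℂ, N.IsSymm →
      QuadraticMap.associated (R := ℂ) N.toQuadraticForm' = Matrix.toLinearMap₂' ℂ N := by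
    intro N hN
    refine QuadraticMap.associated_left_inverse ℂ fun x y => ?_
    simp only [toLinearMap₂'_apply']
    rw [dotProduct_comm, dotProduct_mulVec, dotProduct_comm, ← mulVec_transpose, hN.eq,
      dotProduct_comm]
  have sep : ∀ N : Matrix ι ι ℂ, N.IsSymm → N.det ≠ 0 →
      (QuadraticMap.associated (R := ℂ) N.toQuadraticForm').SeparatingLeft := by
    intro N hN h
    rw [key N hN]
    exact LinearMap.separatingLeft_toLinearMap₂'_iff_det_ne_zero.2 h
  -- Over `ℂ` every nondegenerate form is equivalent to a sum of squares; the transposed matrix of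
  -- the equivalence is `V`.
  obtain ⟨e⟩ := QuadraticForm.equivalent_of_isAlgClosed N.toQuadraticForm'
    (1 : Matrix ι ι ℂ).toQuadraticForm' (sep N hN h) (sep 1 isSymm_one (by simp))
  have h1 : N.toQuadraticForm' = (1 : Matrix ι ι ℂ).toQuadraticForm'.comp e.toLinearMap := by
    ext x
    exact (e.map_app x).symm
  have h2 := congrArg QuadraticForm.toMatrix' h1
  rw [QuadraticForm.toMatrix'_comp] at h2
  simp only [QuadraticForm.toMatrix', key N hN, key 1 isSymm_one,
    LinearMap.toMatrix'_toLinearMap₂', mul_one] at h2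
  exact ⟨_, by rw [transpose_transpose]; exact h2⟩

end Matrix

/-! ### Trace-free matrices as vectors of the quadratic space `ℂ³` -/

/-- The trace-free matrix with coordinates `u`; for real `u` these are the purely imaginary
quaternions. -/
def traceFreeMatrix (u : Fin 3 → ℂ) : Matrix (Fin 2) (Fin 2) ℂ :=
  !![Complex.I * u 0, u 1 + Complex.I * u 2; -u 1 + Complex.I * u 2, -(Complex.I * u 0)]

/-- The coordinates of the trace-free part of a matrix. -/
def traceFreeCoords (X : Matrix (Fin 2) (Fin 2) ℂ) : Fin 3 → ℂ :=
  ![-Complex.I * (X 0 0 - X 1 1) / 2, (X 0 1 - X 1 0) / 2, -Complex.I * (X 0 1 + X 1 0) / 2]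

theorem eq_smul_one_add_traceFreeMatrix (X : Matrix (Fin 2) (Fin 2) ℂ) :
    X = (X.trace / 2) • 1 + traceFreeMatrix (traceFreeCoords X) := by
  ext i j
  fin_cases i <;> fin_cases j <;>
    simp [traceFreeMatrix, traceFreeCoords, trace_fin_two] <;> ring_nf <;>
    simp only [Complex.I_sq] <;> ring

theorem eq_traceFreeMatrix {X : Matrix (Fin 2) (Fin 2) ℂ} (h : X.trace = 0) :
    X = traceFreeMatrix (traceFreeCoords X) := by
  simpa [h] using eq_smul_one_add_traceFreeMatrix X

theorem traceFreeCoords_smul_one_add (t : ℂ) (u : Fin 3 → ℂ) :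
    traceFreeCoords (t • 1 + traceFreeMatrix u) = u := by
  ext i
  fin_cases i <;> simp [traceFreeMatrix, traceFreeCoords] <;> ring_nf <;>
    simp only [Complex.I_sq] <;> ring

theorem trace_smul_one_add_traceFreeMatrix (t : ℂ) (u : Fin 3 → ℂ) :
    (t • 1 + traceFreeMatrix u).trace = 2 * t := by
  simp [traceFreeMatrix, trace_fin_two]
  ring

theorem trace_traceFreeMatrix (u : Fin 3 → ℂ) : (traceFreeMatrix u).trace = 0 := by
  simp [traceFreeMatrix, trace_fin_two]

theorem traceFreeCoords_traceFreeMatrix (u : Fin 3 → ℂ) :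
    traceFreeCoords (traceFreeMatrix u) = u := by
  simpa using traceFreeCoords_smul_one_add 0 u

theorem traceFreeMatrix_injective : Function.Injective traceFreeMatrix :=
  Function.LeftInverse.injective traceFreeCoords_traceFreeMatrix

theorem traceFreeMatrix_add (u v : Fin 3 → ℂ) :
    traceFreeMatrix (u + v) = traceFreeMatrix u + traceFreeMatrix v := by
  ext i j
  fin_cases i <;> fin_cases j <;> simp [traceFreeMatrix] <;> ring

theorem traceFreeMatrix_smul (t : ℂ) (u : Fin 3 → ℂ) :
    traceFreeMatrix (t • u) = t • traceFreeMatrix u := by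
  ext i j
  fin_cases i <;> fin_cases j <;> simp [traceFreeMatrix] <;> ring

theorem det_traceFreeMatrix (u : Fin 3 → ℂ) : (traceFreeMatrix u).det = u ⬝ᵥ u := by
  simp [traceFreeMatrix, det_fin_two, dotProduct, Fin.sum_univ_three]
  ring_nf
  simp only [Complex.I_sq]
  ring

/-- Quaternion multiplication, the source of all the trace formulas below. -/
theorem traceFreeMatrix_mul (u v : Fin 3 → ℂ) :
    traceFreeMatrix u * traceFreeMatrix v =
      (-(u ⬝ᵥ v)) • 1 + traceFreeMatrix (crossProduct u v) := by
  ext i j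
  fin_cases i <;> fin_cases j <;>
    simp [traceFreeMatrix, mul_apply, dotProduct, Fin.sum_univ_three, cross_apply] <;> ring_nf <;>
    simp only [Complex.I_sq] <;> ring

theorem trace_traceFreeMatrix_mul (u v : Fin 3 → ℂ) :
    (traceFreeMatrix u * traceFreeMatrix v).trace = -(2 * (u ⬝ᵥ v)) := by
  rw [traceFreeMatrix_mul, trace_smul_one_add_traceFreeMatrix]
  ring

theorem trace_traceFreeMatrix_mul_mul (U : Fin 3 → Fin 3 → ℂ) :
    (traceFreeMatrix (U 0) * traceFreeMatrix (U 1) * traceFreeMatrix (U 2)).trace =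
      -(2 * (of U).det) := by
  rw [traceFreeMatrix_mul, add_mul, trace_add, trace_traceFreeMatrix_mul]
  simp [trace_traceFreeMatrix, det_fin_three, cross_apply, dotProduct, Fin.sum_univ_three]
  ring

/-- Since the inverse is the negative, conjugation by a meridian and by its inverse agree, so signs
of crossings play no role in the vector equations. -/
theorem traceFreeMatrix_mul_neg {u : Fin 3 → ℂ} (hu : u ⬝ᵥ u = 1) :
    traceFreeMatrix u * -traceFreeMatrix u = 1 := by
  rw [mul_neg, traceFreeMatrix_mul, cross_self, hu]
  ext i j
  fin_cases i <;> fin_cases j <;> simp [traceFreeMatrix]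

/-- Conjugation by a trace-free matrix of determinant one is the half turn about its vector. -/
theorem traceFreeMatrix_mul_comm {u : Fin 3 → ℂ} (hu : u ⬝ᵥ u = 1) (v : Fin 3 → ℂ) :
    traceFreeMatrix v * traceFreeMatrix u =
      traceFreeMatrix u * traceFreeMatrix ((2 * (u ⬝ᵥ v)) • u - v) := by
  rw [sub_eq_add_neg, ← neg_one_smul ℂ v, traceFreeMatrix_add, traceFreeMatrix_smul,
    traceFreeMatrix_smul, mul_add, mul_smul_comm, mul_smul_comm, traceFreeMatrix_mul u u,
    traceFreeMatrix_mul u v, traceFreeMatrix_mul v u, cross_self, hu, ← cross_anticomm u v,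
    dotProduct_comm v u, ← neg_one_smul ℂ (crossProduct u v), traceFreeMatrix_smul]
  have h0 : traceFreeMatrix 0 = 0 := by simpa using traceFreeMatrix_smul 0 0
  rw [h0]
  module

/-! ### Rotations -/

/-- The pairing of `w` with `u × v` is `det(w,u,v)`, which a rotation preserves; nondegeneracy of
the dot product then gives the cross product itself. -/
theorem crossProduct_vecMul {R : Matrix (Fin 3) (Fin 3) ℂ} (hR : R * Rᵀ = 1) (hdet : R.det = 1)
    (u v : Fin 3 → ℂ) :
    crossProduct (u ᵥ* R) (v ᵥ* R) = crossProduct u v ᵥ* R := by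
  have h : ∀ w, (w ᵥ* R) ⬝ᵥ crossProduct (u ᵥ* R) (v ᵥ* R) =
      (w ᵥ* R) ⬝ᵥ (crossProduct u v ᵥ* R) := by
    intro w
    have h1 : (w ᵥ* R) ⬝ᵥ (crossProduct u v ᵥ* R) = w ⬝ᵥ crossProduct u v := by
      rw [← mulVec_transpose R (crossProduct u v), dotProduct_mulVec, vecMul_vecMul, hR,
        vecMul_one]
    have h2 : (![w ᵥ* R, u ᵥ* R, v ᵥ* R] : Matrix (Fin 3) (Fin 3) ℂ) = of ![w, u, v] * R := by
      ext i j
      fin_cases i <;> rfl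
    rw [h1, triple_product_eq_det, triple_product_eq_det, h2, det_mul, hdet, mul_one]
    rfl
  have hR' : Rᵀ * R = 1 := mul_eq_one_comm.1 hR
  refine dotProduct_eq _ _ fun w => ?_
  have := h (w ᵥ* Rᵀ)
  rw [vecMul_vecMul, hR', vecMul_one] at this
  rw [dotProduct_comm, this, dotProduct_comm]

/-- The automorphism of the algebra of two by two matrices induced by a rotation of the space of
trace-free matrices. -/
def rotateHom (R : Matrix (Fin 3) (Fin 3) ℂ) (hR : R * Rᵀ = 1) (hdet : R.det = 1) :
    Matrix (Fin 2) (Fin 2) ℂ →* Matrix (Fin 2) (Fin 2) ℂ where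
  toFun X := (X.trace / 2) • 1 + traceFreeMatrix (traceFreeCoords X ᵥ* R)
  map_one' := by
    have : traceFreeCoords 1 = 0 := by
      ext i
      fin_cases i <;> simp [traceFreeCoords]
    have h0 : traceFreeMatrix 0 = 0 := by simpa using traceFreeMatrix_smul 0 0
    rw [this, zero_vecMul, h0]
    simp
  map_mul' X Y := by
    -- The product is written with dot and cross products only, both compatible with `R`.
    have key : ∀ (s t : ℂ) (u v : Fin 3 → ℂ),
        (s • 1 + traceFreeMatrix u) * (t • 1 + traceFreeMatrix v) =
          (s * t - u ⬝ᵥ v) • 1 + traceFreeMatrix (s • v + t • u + crossProduct u v) := by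
      intro s t u v
      rw [traceFreeMatrix_add, traceFreeMatrix_add, traceFreeMatrix_smul, traceFreeMatrix_smul,
        add_mul, mul_add, mul_add, traceFreeMatrix_mul, smul_mul_smul_comm, smul_mul_assoc,
        mul_smul_comm, one_mul, mul_one, one_mul]
      module
    have hXY : X * Y = _ := (congrArg₂ (· * ·) (eq_smul_one_add_traceFreeMatrix X)
      (eq_smul_one_add_traceFreeMatrix Y)).trans (key _ _ _ _)
    have hdot : ∀ u v : Fin 3 → ℂ, (u ᵥ* R) ⬝ᵥ (v ᵥ* R) = u ⬝ᵥ v := by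
      intro u v
      rw [← mulVec_transpose R v, dotProduct_mulVec, vecMul_vecMul, hR, vecMul_one]
    rw [key, hdot, crossProduct_vecMul hR hdet, hXY, trace_smul_one_add_traceFreeMatrix,
      traceFreeCoords_smul_one_add, add_vecMul, add_vecMul, smul_vecMul, smul_vecMul,
      mul_div_cancel_left₀ _ two_ne_zero]

theorem trace_rotateHom (R : Matrix (Fin 3) (Fin 3) ℂ) (hR : R * Rᵀ = 1) (hdet : R.det = 1)
    (X : Matrix (Fin 2) (Fin 2) ℂ) : (rotateHom R hR hdet X).trace = X.trace := by
  refine (trace_smul_one_add_traceFreeMatrix _ _).trans ?_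
  ring

theorem rotateHom_traceFreeMatrix (R : Matrix (Fin 3) (Fin 3) ℂ) (hR : R * Rᵀ = 1)
    (hdet : R.det = 1) (u : Fin 3 → ℂ) :
    rotateHom R hR hdet (traceFreeMatrix u) = traceFreeMatrix (u ᵥ* R) := by
  simp [rotateHom, trace_traceFreeMatrix, traceFreeCoords_traceFreeMatrix]

/-! ### Trace-free matrices in `SU(2)` -/

/-- For a real vector the matrix is anti-Hermitian, so its adjoint is its inverse. -/
theorem traceFreeMatrix_mem_specialUnitaryGroup (x : Fin 3 → ℝ)
    (hx : (fun i => (x i : ℂ)) ⬝ᵥ (fun i => (x i : ℂ)) = 1) :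
    traceFreeMatrix (fun i => (x i : ℂ)) ∈ specialUnitaryGroup (Fin 2) ℂ := by
  rw [mem_specialUnitaryGroup_iff, det_traceFreeMatrix, mem_unitaryGroup_iff]
  refine ⟨?_, hx⟩
  have : star (traceFreeMatrix fun i => (x i : ℂ)) = -traceFreeMatrix fun i => (x i : ℂ) := by
    ext i j
    fin_cases i <;> fin_cases j <;> simp [traceFreeMatrix, star_apply] <;> ring
  rw [this, traceFreeMatrix_mul_neg hx]

/-- The adjoint is the inverse `-X`, while taking adjoints negates and conjugates the coordinates;
so these are real. -/
theorem exists_real_coords_of_mem_specialUnitaryGroup {X : Matrix (Fin 2) (Fin 2) ℂ}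
    (hX : X ∈ specialUnitaryGroup (Fin 2) ℂ) (h : X.trace = 0) :
    ∃ x : Fin 3 → ℝ, X = traceFreeMatrix fun i => (x i : ℂ) := by
  obtain ⟨hU, hdet⟩ := mem_specialUnitaryGroup_iff.1 hX
  have hX1 := eq_traceFreeMatrix h
  set u := traceFreeCoords X
  have huu : u ⬝ᵥ u = 1 := by rw [← det_traceFreeMatrix, ← hX1, hdet]
  have hstar : star X = -X := by
    have h1 : star X * X = 1 := mem_unitaryGroup_iff'.1 hU
    have h2 : X * -X = 1 := by rw [hX1]; exact traceFreeMatrix_mul_neg huu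
    exact left_inv_eq_right_inv h1 h2
  have hu : ∀ i, (starRingEnd ℂ) (u i) = u i := by
    have h2 : star X = traceFreeMatrix (-(fun i => (starRingEnd ℂ) (u i))) := by
      rw [hX1]
      ext i j
      fin_cases i <;> fin_cases j <;> simp [traceFreeMatrix, star_apply]
    rw [hstar, hX1, ← neg_one_smul ℂ (traceFreeMatrix u), ← traceFreeMatrix_smul] at h2
    intro i
    have := congrFun (traceFreeMatrix_injective h2) i
    simpa using this.symm
  refine ⟨fun i => (u i).re, ?_⟩
  rw [hX1]
  congr 1
  ext i
  exact (Complex.conj_eq_iff_re.1 (hu i)).symm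

/-- The inclusion of `SL₂(ℂ)` in the algebra of matrices. -/
def slInclusion : SpecialLinearGroup (Fin 2) ℂ →* Matrix (Fin 2) (Fin 2) ℂ where
  toFun A := A
  map_one' := rfl
  map_mul' _ _ := rfl

/-! ### Gram vector models of augmentations. -/

namespace KnotDiagram

variable {D : KnotDiagram} {ε : D.PairCoords}

theorem cordMatrix_self (ε : D.PairCoords) (r : D.Arc) : D.cordMatrix ε r r = 2 := by
  simp [cordMatrix]

theorem cordMatrix_comm (ε : D.PairCoords) (r s : D.Arc) :
    D.cordMatrix ε r s = D.cordMatrix ε s r := by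
  have h : s(r, s) = s(s, r) := Sym2.eq_swap
  simp only [cordMatrix, of_apply]
  congr! 2
  exact Subtype.ext h

theorem cordMatrix_isSymm (ε : D.PairCoords) : (D.cordMatrix ε).IsSymm := by
  ext r s
  exact cordMatrix_comm ε s r

/-- A realization of `[ε_rs]` as a Gram matrix of vectors of `ℂ³`. -/
def IsVectorModel (ε : D.PairCoords) (U : D.Arc → Fin 3 → ℂ) : Prop :=
  ∀ r s, D.cordMatrix ε r s = 2 * (U r ⬝ᵥ U s)

theorem isVectorModel_iff {U : D.Arc → Fin 3 → ℂ} :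
    IsVectorModel ε U ↔ D.cordMatrix ε = (2 : ℂ) • (of U * (of U)ᵀ) := by
  rw [← Matrix.ext_iff]
  rfl

theorem IsVectorModel.dotProduct_self {U : D.Arc → Fin 3 → ℂ} (hU : IsVectorModel ε U)
    (r : D.Arc) : U r ⬝ᵥ U r = 1 := by
  have h := hU r r
  rw [cordMatrix_self] at h
  linear_combination -h / 2

/-- With this, `σ² = T/2` means `σ = ±2 det`, and `T ≥ 0` for real models. -/
theorem IsVectorModel.minor_eq {U : D.Arc → Fin 3 → ℂ} (hU : IsVectorModel ε U)
    (a : Fin 3 → D.Arc) : D.minor ε a = 8 * (of fun i => U (a i)).det ^ 2 := by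
  have : (D.cordMatrix ε).submatrix a a =
      (2 : ℂ) • ((of fun i => U (a i)) * (of fun i => U (a i))ᵀ) := by
    ext i j
    exact hU (a i) (a j)
  rw [minor, this, det_smul, det_mul, det_transpose, Fintype.card_fin]
  ring

theorem IsVectorModel.det_ne_zero {U : D.Arc → Fin 3 → ℂ} (hU : IsVectorModel ε U)
    {a : Fin 3 → D.Arc} (ha : D.minor ε a ≠ 0) : (of fun i => U (a i)).det ≠ 0 := by
  rw [hU.minor_eq] at ha
  intro h
  simp [h] at ha

/-- Two vectors with the same products with three independent ones agree. -/
theorem eq_of_dotProduct_eq {V : Fin 3 → Fin 3 → ℂ} (hV : (of V).det ≠ 0) {x y : Fin 3 → ℂ}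
    (h : ∀ i, V i ⬝ᵥ x = V i ⬝ᵥ y) : x = y := by
  have hunit : IsUnit (of V) := (isUnit_iff_isUnit_det _).2 (isUnit_iff_ne_zero.2 hV)
  exact mulVec_injective_of_isUnit hunit (funext h)

theorem exists_coeff (hrank : D.augRank ε = 3) {a : Fin 3 → D.Arc} (ha : D.minor ε a ≠ 0) :
    ∃ C : Matrix D.Arc (Fin 3) ℂ,
      (D.cordMatrix ε).submatrix id a = C * (D.cordMatrix ε).submatrix a a ∧
      D.cordMatrix ε = C * (D.cordMatrix ε).submatrix a a * Cᵀ :=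
  (cordMatrix_isSymm ε).exists_eq_mul_submatrix_mul a
    (row_mem_span_of_det_submatrix_ne_zero hrank ha)

theorem exists_isVectorModel (hrank : D.augRank ε = 3) {a : Fin 3 → D.Arc}
    (ha : D.minor ε a ≠ 0) : ∃ U : D.Arc → Fin 3 → ℂ, IsVectorModel ε U := by
  obtain ⟨C, -, hC⟩ := exists_coeff hrank ha
  obtain ⟨V, hV⟩ := ((cordMatrix_isSymm ε).submatrix a).exists_eq_mul_transpose ha
  -- The scale `t` absorbs the factor 2 between `ε` and the dot product.
  obtain ⟨t, ht⟩ := IsAlgClosed.exists_pow_nat_eq (1 / 2 : ℂ) two_pos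
  refine ⟨fun l => (t • (C * V)) l, isVectorModel_iff.2 ?_⟩
  change _ = (2 : ℂ) • (t • (C * V) * (t • (C * V))ᵀ)
  rw [transpose_smul, Matrix.smul_mul, Matrix.mul_smul, smul_smul, smul_smul, transpose_mul, mul_assoc,
    ← pow_two, ht, Matrix.mul_assoc C V, ← Matrix.mul_assoc V, ← hV, ← Matrix.mul_assoc, ← hC]
  norm_num

/-- The columns `a` determine a symmetric matrix of rank three, so an explicit model need only be
tested against three arcs. -/
theorem isVectorModel_of_forall (hrank : D.augRank ε = 3) {a : Fin 3 → D.Arc}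
    (ha : D.minor ε a ≠ 0) {U : D.Arc → Fin 3 → ℂ}
    (hU : ∀ l i, D.cordMatrix ε l (a i) = 2 * (U l ⬝ᵥ U (a i))) : IsVectorModel ε U := by
  obtain ⟨C, hC1, hC⟩ := exists_coeff hrank ha
  set V : Matrix (Fin 3) (Fin 3) ℂ := of fun i => U (a i)
  have hN : (D.cordMatrix ε).submatrix a a = (2 : ℂ) • (V * Vᵀ) := by
    ext i j
    exact hU (a i) j
  have hV : IsUnit V.det := by
    rw [isUnit_iff_ne_zero]
    intro h
    apply ha
    rw [minor, hN, det_smul, det_mul, h]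
    simp
  have hUV : of U * Vᵀ = C * V * Vᵀ := by
    have h1 : (D.cordMatrix ε).submatrix id a = (2 : ℂ) • (of U * Vᵀ) := by
      ext l i
      exact hU l i
    rw [h1, hN, Matrix.mul_smul] at hC1
    rw [Matrix.mul_assoc]
    exact smul_right_injective _ (two_ne_zero (α := ℂ)) hC1
  have hVt : IsUnit Vᵀ.det := by rwa [det_transpose]
  have hUC : of U = C * V := by
    have := congrArg (· * (Vᵀ)⁻¹) hUV
    simpa [Matrix.mul_nonsing_inv_cancel_right _ _ hVt] using this
  rw [isVectorModel_iff, hUC, transpose_mul]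
  conv_lhs => rw [hC, hN]
  simp only [Matrix.mul_smul, Matrix.smul_mul, Matrix.mul_assoc]

/-! ### Representations from vector models -/

/-- The augmentation equations with `l = a i` compare the products of both sides with a basis. -/
theorem IsVectorModel.underOut_eq {U : D.Arc → Fin 3 → ℂ} (hU : IsVectorModel ε U)
    (hε : ε ∈ D.augVariety) {a : Fin 3 → D.Arc} (ha : D.minor ε a ≠ 0) (c : Fin D.n) :
    U (D.underOut c) = (2 * (U (D.overArc c) ⬝ᵥ U (D.underIn c))) • U (D.overArc c)
      - U (D.underIn c) := by
  refine eq_of_dotProduct_eq (hU.det_ne_zero ha) fun i => ?_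
  have h := hε c (a i)
  simp only [hU _ _] at h
  rw [dotProduct_sub, dotProduct_smul, smul_eq_mul]
  linear_combination h / 2

/-- The group `G` is left open so as to serve both `SL₂(ℂ)` and `SU(2)`. -/
theorem IsVectorModel.exists_hom {U : D.Arc → Fin 3 → ℂ} (hU : IsVectorModel ε U)
    (hε : ε ∈ D.augVariety) {a : Fin 3 → D.Arc} (ha : D.minor ε a ≠ 0) {G : Type*} [Group G]
    (j : G →* Matrix (Fin 2) (Fin 2) ℂ) (hj : Function.Injective j) (g : D.Arc → G)
    (hg : ∀ l, j (g l) = traceFreeMatrix (U l)) :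
    ∃ ρ : D.KnotGroup →* G, ∀ l, ρ (D.meridian l) = g l := by
  have hrel : ∀ c, g (D.underIn c) * g (D.overArc c) = g (D.overArc c) * g (D.underOut c) := by
    intro c
    apply hj
    rw [map_mul, map_mul, hg, hg, hg, hU.underOut_eq hε ha,
      traceFreeMatrix_mul_comm (hU.dotProduct_self _)]
  -- A half turn is an involution, so the under strands may be exchanged; negative crossings need
  -- this form.
  have hrel' : ∀ c, g (D.overArc c) * g (D.underIn c) = g (D.underOut c) * g (D.overArc c) := by
    intro c
    apply hj
    rw [map_mul, map_mul, hg, hg, hg, hU.underOut_eq hε ha,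
      traceFreeMatrix_mul_comm (hU.dotProduct_self (D.overArc c))]
    congr 2
    rw [dotProduct_sub, dotProduct_smul, hU.dotProduct_self, smul_eq_mul]
    module
  have hone : ∀ r ∈ D.wirtingerRels, FreeGroup.lift g r = 1 := by
    rintro _ ⟨c, rfl⟩
    rcases Int.units_eq_one_or (D.sign c) with h | h
    · simp only [h, map_mul, map_inv, FreeGroup.lift_apply_of, Units.val_one, zpow_one,
        _root_.zpow_neg]
      rw [hrel c]
      group
    · simp only [h, map_mul, map_inv, FreeGroup.lift_apply_of, Units.val_neg,
        Units.val_one, zpow_one, _root_.zpow_neg, neg_neg]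
      have h1 : g (D.underIn c) * (g (D.overArc c))⁻¹ = (g (D.overArc c))⁻¹ * g (D.underOut c) := by
        rw [eq_inv_mul_iff_mul_eq, ← mul_assoc, hrel' c, mul_inv_cancel_right]
      rw [h1]
      group
  exact ⟨PresentedGroup.toGroup hone, fun l => PresentedGroup.toGroup.of hone⟩

/-! ### Characters in terms of vector models. -/

/-- A vector model and the orientation of one of its bases determine the character. -/
theorem IsVectorModel.trace_eq {U U' : D.Arc → Fin 3 → ℂ} (hU : IsVectorModel ε U)
    (hU' : IsVectorModel ε U') {a : Fin 3 → D.Arc} (ha : D.minor ε a ≠ 0)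
    (hdet : (of fun i => U (a i)).det = (of fun i => U' (a i)).det)
    {ψ ψ' : D.KnotGroup →* Matrix (Fin 2) (Fin 2) ℂ}
    (hψ : ∀ l, ψ (D.meridian l) = traceFreeMatrix (U l))
    (hψ' : ∀ l, ψ' (D.meridian l) = traceFreeMatrix (U' l)) (g : D.KnotGroup) :
    (ψ g).trace = (ψ' g).trace := by
  have hV := hU.det_ne_zero ha
  set V : Matrix (Fin 3) (Fin 3) ℂ := of fun i => U (a i) with hVdef
  set V' : Matrix (Fin 3) (Fin 3) ℂ := of fun i => U' (a i) with hVdef'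
  have hVu : IsUnit V.det := isUnit_iff_ne_zero.2 hV
  have hVu' : IsUnit V'.det := hdet ▸ hVu
  have hVV : V * Vᵀ = V' * V'ᵀ := by
    ext i j
    have := (hU (a i) (a j)).symm.trans (hU' (a i) (a j))
    exact mul_left_cancel₀ two_ne_zero this
  -- `V⁻¹ * V'` carries one basis to the other; equal Gram matrices make it orthogonal.
  have hR : (V⁻¹ * V') * (V⁻¹ * V')ᵀ = 1 := by
    rw [transpose_mul, Matrix.mul_assoc, ← Matrix.mul_assoc V', ← hVV, ← Matrix.mul_assoc,
      ← Matrix.mul_assoc, nonsing_inv_mul _ hVu, Matrix.one_mul, ← transpose_mul,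
      nonsing_inv_mul _ hVu, transpose_one]
  have hRdet : (V⁻¹ * V').det = 1 := by
    rw [det_mul, ← hdet, ← det_mul, nonsing_inv_mul _ hVu, det_one]
  have hUR : ∀ l, U l ᵥ* (V⁻¹ * V') = U' l := by
    intro l
    refine eq_of_dotProduct_eq (hdet ▸ hV : V'.det ≠ 0) fun i => ?_
    have h1 : V' i = V i ᵥ* (V⁻¹ * V') := by
      change V'.row i = (V * (V⁻¹ * V')).row i
      rw [← Matrix.mul_assoc, mul_nonsing_inv _ hVu, Matrix.one_mul]
    have h2 : (fun i => U' (a i)) i ⬝ᵥ (U l ᵥ* (V⁻¹ * V')) = V i ⬝ᵥ U l := by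
      change V' i ⬝ᵥ _ = _
      rw [h1, ← mulVec_transpose _ (U l), dotProduct_mulVec, vecMul_vecMul, hR, vecMul_one]
    have h3 := (hU (a i) l).symm.trans (hU' (a i) l)
    exact h2.trans (mul_left_cancel₀ two_ne_zero h3)
  -- Passing to units gives homomorphisms of groups, which agree once they agree on generators.
  have hcomp : ((rotateHom _ hR hRdet).comp ψ).toHomUnits = ψ'.toHomUnits := by
    refine PresentedGroup.ext fun l => Units.ext ?_
    change rotateHom _ hR hRdet (ψ (D.meridian l)) = ψ' (D.meridian l)
    rw [hψ, hψ', rotateHom_traceFreeMatrix, hUR]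
  have hg : rotateHom _ hR hRdet (ψ g) = ψ' g :=
    congrArg Units.val (DFunLike.congr_fun hcomp g)
  rw [← hg, trace_rotateHom]

theorem map_meridian_inv {ψ : D.KnotGroup →* Matrix (Fin 2) (Fin 2) ℂ} {l : D.Arc}
    {u : Fin 3 → ℂ} (hψ : ψ (D.meridian l) = traceFreeMatrix u) (hu : u ⬝ᵥ u = 1) :
    ψ (D.meridian l)⁻¹ = -traceFreeMatrix u :=
  left_inv_eq_right_inv (by rw [← map_mul, inv_mul_cancel, map_one])
    (by rw [hψ, traceFreeMatrix_mul_neg hu])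

/-- The vector model of a trace-free representation. -/
theorem isVectorModel_of_hom {ψ : D.KnotGroup →* Matrix (Fin 2) (Fin 2) ℂ}
    {U : D.Arc → Fin 3 → ℂ} (hψ : ∀ l, ψ (D.meridian l) = traceFreeMatrix (U l))
    (hdet : ∀ l, (ψ (D.meridian l)).det = 1)
    (hε : ∀ r s, r ≠ s → (ψ (D.meridian r * (D.meridian s)⁻¹)).trace = D.cordMatrix ε r s) :
    IsVectorModel ε U := by
  have huu : ∀ l, U l ⬝ᵥ U l = 1 := fun l => by rw [← det_traceFreeMatrix, ← hψ, hdet]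
  intro r s
  by_cases hrs : r = s
  · rw [hrs, cordMatrix_self, huu, mul_one]
  · rw [← hε r s hrs, map_mul, hψ, map_meridian_inv (hψ s) (huu s),
      mul_neg, trace_neg, trace_traceFreeMatrix_mul, neg_neg]

theorem IsVectorModel.det_eq_or {U : D.Arc → Fin 3 → ℂ} (hU : IsVectorModel ε U)
    {a : Fin 3 → D.Arc} {σ : ℂ} (hσ : σ ^ 2 = D.minor ε a / 2) :
    2 * (of fun i => U (a i)).det = σ ∨ 2 * (of fun i => U (a i)).det = -σ := by
  rw [hU.minor_eq] at hσ
  apply sq_eq_sq_iff_eq_or_eq_neg.1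
  linear_combination -hσ

/-- Replacing `U` by `-U` keeps the Gram matrix and, in odd dimension, reverses the determinant. -/
theorem exists_isVectorModel_det (hrank : D.augRank ε = 3) {a : Fin 3 → D.Arc}
    (ha : D.minor ε a ≠ 0) {σ : ℂ} (hσ : σ ^ 2 = D.minor ε a / 2) :
    ∃ U : D.Arc → Fin 3 → ℂ, IsVectorModel ε U ∧ 2 * (of fun i => U (a i)).det = σ := by
  obtain ⟨U, hU⟩ := exists_isVectorModel hrank ha
  rcases hU.det_eq_or hσ with h | h
  · exact ⟨U, hU, h⟩
  · refine ⟨fun l => -U l, fun r s => by rw [neg_dotProduct_neg, hU], ?_⟩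
    have : (of fun i => -U (a i)) = -(of fun i => U (a i)) := rfl
    rw [this, det_neg, Fintype.card_fin]
    linear_combination -h

/-- The conditions on the coordinates of `𝔛(ε)`, for the trace of a matrix representation, in terms
of its vector model. -/
theorem IsFrakX.exists_isVectorModel {a : Fin 3 → D.Arc} {σ : ℂ} {χ : D.KnotGroup → ℂ}
    (hχ : D.IsFrakX ε a σ χ) {ψ : D.KnotGroup →* Matrix (Fin 2) (Fin 2) ℂ}
    (hψ : ∀ g, χ g = (ψ g).trace) (hdet : ∀ g, (ψ g).det = 1) {U : D.Arc → Fin 3 → ℂ}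
    (hU : ∀ l, ψ (D.meridian l) = traceFreeMatrix (U l)) :
    IsVectorModel ε U ∧ 2 * (of fun i => U (a i)).det = σ := by
  obtain ⟨-, h1, h2⟩ := hχ
  refine ⟨isVectorModel_of_hom hU (fun l => hdet _) fun r s hrs => by rw [← hψ, h1 r s hrs], ?_⟩
  rw [← h2, hψ, map_mul, map_mul, hU, hU, hU, trace_traceFreeMatrix_mul_mul fun i => U (a i),
    neg_neg]

theorem IsVectorModel.isFrakX {U : D.Arc → Fin 3 → ℂ} (hU : IsVectorModel ε U)
    {a : Fin 3 → D.Arc} {σ : ℂ} (hdet : 2 * (of fun i => U (a i)).det = σ)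
    {ρ : D.KnotGroup →* SpecialLinearGroup (Fin 2) ℂ}
    (hρ : ∀ l, (ρ (D.meridian l) : Matrix (Fin 2) (Fin 2) ℂ) = traceFreeMatrix (U l)) :
    D.IsFrakX ε a σ fun g => (ρ g : Matrix (Fin 2) (Fin 2) ℂ).trace := by
  have hψ : ∀ l, slInclusion.comp ρ (D.meridian l) = traceFreeMatrix (U l) := hρ
  refine ⟨⟨ρ, fun r => by rw [hρ, trace_traceFreeMatrix], fun g => rfl⟩, fun r s _ => ?_, ?_⟩
  · change (slInclusion.comp ρ (D.meridian r * (D.meridian s)⁻¹)).trace = _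
    rw [map_mul, hψ, map_meridian_inv (hψ s) (hU.dotProduct_self s), mul_neg, trace_neg,
      trace_traceFreeMatrix_mul, neg_neg, hU]
  · change -(slInclusion.comp ρ (D.meridian (a 0) * D.meridian (a 1) * D.meridian (a 2))).trace = _
    rw [map_mul, map_mul, hψ, hψ, hψ, trace_traceFreeMatrix_mul_mul fun i => U (a i), neg_neg,
      hdet]

theorem exists_isFrakX (hε : ε ∈ D.augVariety) (hrank : D.augRank ε = 3) {a : Fin 3 → D.Arc}
    (ha : D.minor ε a ≠ 0) {σ : ℂ} (hσ : σ ^ 2 = D.minor ε a / 2) : ∃ χ, D.IsFrakX ε a σ χ := by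
  obtain ⟨U, hU, hdet⟩ := exists_isVectorModel_det hrank ha hσ
  obtain ⟨ρ, hρ⟩ := hU.exists_hom hε ha slInclusion Subtype.val_injective
    (fun l => ⟨traceFreeMatrix (U l), by rw [det_traceFreeMatrix, hU.dotProduct_self]⟩)
    (fun l => rfl)
  exact ⟨_, hU.isFrakX hdet fun l => by rw [hρ]⟩

theorem IsFrakX.trace_meridian {a : Fin 3 → D.Arc} {σ : ℂ} {χ : D.KnotGroup → ℂ}
    (hχ : D.IsFrakX ε a σ χ) (l : D.Arc) : χ (D.meridian l) = 0 := by
  obtain ⟨⟨ρ, h1, h2⟩, -⟩ := hχ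
  rw [h2, h1]

/-- Every matrix representation whose vector model has the right orientation has the
character `𝔛(ε)`. -/
theorem IsFrakX.eq_trace {a : Fin 3 → D.Arc} {σ : ℂ} {χ : D.KnotGroup → ℂ}
    (hχ : D.IsFrakX ε a σ χ) (ha : D.minor ε a ≠ 0) {U : D.Arc → Fin 3 → ℂ}
    (hU : IsVectorModel ε U) (hdet : 2 * (of fun i => U (a i)).det = σ)
    {ψ : D.KnotGroup →* Matrix (Fin 2) (Fin 2) ℂ}
    (hψ : ∀ l, ψ (D.meridian l) = traceFreeMatrix (U l)) (g : D.KnotGroup) :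
    χ g = (ψ g).trace := by
  obtain ⟨⟨ρ, h1, h2⟩, -⟩ := id hχ
  have hρ : ∀ l, slInclusion.comp ρ (D.meridian l) =
      traceFreeMatrix (traceFreeCoords (ρ (D.meridian l) : Matrix (Fin 2) (Fin 2) ℂ)) :=
    fun l => eq_traceFreeMatrix (h1 l)
  obtain ⟨hU', hdet'⟩ := hχ.exists_isVectorModel (ψ := slInclusion.comp ρ) h2
    (fun g => (ρ g).2) hρ
  rw [h2]
  exact hU'.trace_eq hU ha (mul_left_cancel₀ two_ne_zero (hdet'.trans hdet.symm)) hρ hψ g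

theorem IsFrakX.unique {a : Fin 3 → D.Arc} {σ : ℂ} {χ χ' : D.KnotGroup → ℂ}
    (ha : D.minor ε a ≠ 0) (hχ : D.IsFrakX ε a σ χ) (hχ' : D.IsFrakX ε a σ χ') : χ' = χ := by
  obtain ⟨⟨ρ, h1, h2⟩, -⟩ := id hχ
  have hρ : ∀ l, slInclusion.comp ρ (D.meridian l) =
      traceFreeMatrix (traceFreeCoords (ρ (D.meridian l) : Matrix (Fin 2) (Fin 2) ℂ)) :=
    fun l => eq_traceFreeMatrix (h1 l)
  obtain ⟨hU, hdet⟩ := hχ.exists_isVectorModel (ψ := slInclusion.comp ρ) h2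
    (fun g => (ρ g).2) hρ
  ext g
  rw [h2]
  exact hχ'.eq_trace ha hU hdet hρ g

/-- A representation in `SU(2)` with character `𝔛(ε)` has a real vector model. -/
theorem IsFrakX.exists_real_model {a : Fin 3 → D.Arc} {σ : ℂ} {χ : D.KnotGroup → ℂ}
    (hχ : D.IsFrakX ε a σ χ) {ρ : D.KnotGroup →* specialUnitaryGroup (Fin 2) ℂ}
    (hρ : D.IsCharacterOf χ ρ) :
    ∃ x : D.Arc → Fin 3 → ℝ, IsVectorModel ε (fun l i => (x l i : ℂ)) ∧
      ∀ l, (ρ (D.meridian l) : Matrix (Fin 2) (Fin 2) ℂ) =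
        traceFreeMatrix fun i => (x l i : ℂ) := by
  have h : ∀ l, ∃ x : Fin 3 → ℝ, (ρ (D.meridian l) : Matrix (Fin 2) (Fin 2) ℂ) =
      traceFreeMatrix fun i => (x i : ℂ) := fun l =>
    exists_real_coords_of_mem_specialUnitaryGroup (ρ (D.meridian l)).2
      (by rw [← hρ, hχ.trace_meridian])
  choose x hx using h
  exact ⟨x, (hχ.exists_isVectorModel (ψ := (specialUnitaryGroup (Fin 2) ℂ).subtype.comp ρ) hρ
    (fun g => (mem_specialUnitaryGroup_iff.1 (ρ g).2).2) hx).1, hx⟩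

/-! ### Binary-dihedral representations -/

/-- A property of arcs that is kept on passing under a crossing is shared by all arcs or by none. -/
theorem arc_iff_of_underIn_iff_underOut {P : D.Arc → Prop} (h : ∀ c, P (D.underIn c) ↔ P (D.underOut c))
    (r s : D.Arc) : P r ↔ P s := by
  have hnext : ∀ p : Fin D.n × Bool, P (Quot.mk _ p) ↔ P (Quot.mk _ (D.next p)) := by
    intro p
    rcases hq : D.next p with ⟨c, b⟩
    cases b
    · have hp : p = D.next.symm (c, false) := by rw [← hq, Equiv.symm_apply_apply]
      rw [hp]
      exact h c
    · have : (Quot.mk _ p : D.Arc) = Quot.mk _ (c, true) := Quot.sound ⟨hq.symm, rfl⟩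
      rw [this]
  have hpow : ∀ (n : ℕ) (p : Fin D.n × Bool),
      P (Quot.mk _ p) ↔ P (Quot.mk _ ((D.next ^ n) p)) := by
    intro n
    induction n with
    | zero => intro p; rfl
    | succ n ih =>
      intro p
      rw [pow_succ, Equiv.Perm.mul_apply, ← ih, ← hnext]
  induction r using Quot.ind with | _ p
  induction s using Quot.ind with | _ q
  obtain ⟨n, hn⟩ := (D.one_component.2 (Set.mem_univ p) (Set.mem_univ q)).exists_nat_pow_eq
  rw [hpow n p, hn]

/-- Binary-dihedral meridians lie on an axis or in its orthogonal plane. Half turns about either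
kind preserve both kinds, so along the knot all vectors are of one kind and cannot span. -/
theorem IsFrakX.not_isBinaryDihedralCharacter {a : Fin 3 → D.Arc} {σ : ℂ} {χ : D.KnotGroup → ℂ}
    (hε : ε ∈ D.augVariety) (ha : D.minor ε a ≠ 0) (hχ : D.IsFrakX ε a σ χ) :
    ¬ D.IsBinaryDihedralCharacter χ := by
  rintro ⟨ρ, hρ, hdih⟩
  obtain ⟨x, hU, hx⟩ := hχ.exists_real_model hρ
  have hdet := hU.det_ne_zero ha
  have hcase : ∀ l, (x l 1 = 0 ∧ x l 2 = 0) ∨ x l 0 = 0 := by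
    intro l
    rcases hdih (D.meridian l) with ⟨h1, h2⟩ | ⟨h1, -⟩
    · left
      rw [hx] at h1 h2
      simp only [traceFreeMatrix, of_apply, cons_val', cons_val_zero, cons_val_one,
        cons_val_fin_one] at h1 h2
      have h3 := congrArg Complex.re h1
      have h4 := congrArg Complex.im h1
      simp at h3 h4
      exact ⟨h3, h4⟩
    · right
      rw [hx] at h1
      simpa [traceFreeMatrix] using h1
  have hstep : ∀ c, x (D.underIn c) 0 = 0 ↔ x (D.underOut c) 0 = 0 := by
    intro c
    have hk : ∀ i, x (D.underOut c) i = 2 * (∑ m, x (D.overArc c) m * x (D.underIn c) m) *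
        x (D.overArc c) i - x (D.underIn c) i := by
      intro i
      have := congrFun (hU.underOut_eq hε ha c) i
      simp only [dotProduct, Pi.sub_apply, Pi.smul_apply, smul_eq_mul] at this
      exact_mod_cast this
    have h0 := hk 0
    rw [Fin.sum_univ_three] at h0
    have hone : x (D.overArc c) 0 ^ 2 + x (D.overArc c) 1 ^ 2 + x (D.overArc c) 2 ^ 2 = 1 := by
      have := hU.dotProduct_self (D.overArc c)
      simp only [dotProduct, Fin.sum_univ_three, ← pow_two] at this
      exact_mod_cast this
    rcases hcase (D.overArc c) with ⟨h1, h2⟩ | h1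
    · simp only [h1, h2] at h0 hone
      have : x (D.underOut c) 0 = x (D.underIn c) 0 := by
        linear_combination h0 + 2 * x (D.underIn c) 0 * hone
      rw [this]
    · simp only [h1] at h0
      have : x (D.underOut c) 0 = -x (D.underIn c) 0 := by linear_combination h0
      rw [this, neg_eq_zero]
  apply hdet
  by_cases h0 : x (a 0) 0 = 0
  · have hall : ∀ l, x l 0 = 0 := fun l =>
      (arc_iff_of_underIn_iff_underOut (P := fun l => x l 0 = 0) hstep _ l).1 h0
    exact det_eq_zero_of_column_eq_zero 0 fun i => by simp [hall]
  · have hall : ∀ l, x l 1 = 0 := fun l => ((hcase l).resolve_right fun hl =>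
      h0 ((arc_iff_of_underIn_iff_underOut (P := fun l => x l 0 = 0) hstep _ l).2 hl)).1
    exact det_eq_zero_of_column_eq_zero 1 fun i => by simp [hall]

/-! ### Elliptic augmentations -/

/-- So `ε(r,s,t) < 2` means `T > 0`: the three arcs give a basis. -/
theorem triple_eq (ε : D.PairCoords) (r s t : D.Arc) :
    D.triple ε r s t = 2 - D.minor ε ![r, s, t] / 2 := by
  rw [triple, minor, det_fin_three]
  simp only [submatrix_apply, cons_val_zero, cons_val_one, cons_val, cordMatrix_self,
    cordMatrix_comm ε s r, cordMatrix_comm ε t r, cordMatrix_comm ε t s]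
  ring

theorem sq_add_sq_add_sq_sub_mul_nonneg {x y z : ℝ} (hz : z ∈ Set.Icc (-2 : ℝ) 2) :
    0 ≤ x ^ 2 + y ^ 2 + z ^ 2 - x * y * z := by
  obtain ⟨h1, h2⟩ := hz
  -- `4(x² + y² - xyz) = (2 - z)(x + y)² + (2 + z)(x - y)²`.
  nlinarith [mul_nonneg (sub_nonneg.2 h2) (sq_nonneg (x + y)),
    mul_nonneg (by linarith : 0 ≤ z + 2) (sq_nonneg (x - y)), sq_nonneg z]

/-- The pair bounds are Cauchy–Schwarz for unit vectors; the upper triple bound is `2 - 4 det² ≤ 2`.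
-/
theorem IsVectorModel.isElliptic {x : D.Arc → Fin 3 → ℝ}
    (hU : IsVectorModel ε fun l i => (x l i : ℂ)) : D.IsElliptic ε := by
  have hreal : ∀ r s, D.cordMatrix ε r s = ((2 * (x r ⬝ᵥ x s) : ℝ) : ℂ) := by
    intro r s
    rw [hU r s]
    simp [dotProduct]
  have hone : ∀ r, x r ⬝ᵥ x r = 1 := by
    intro r
    have h := hreal r r
    rw [cordMatrix_self] at h
    have h' : (2 : ℝ) = 2 * (x r ⬝ᵥ x r) := by exact_mod_cast h
    linarith
  have hmem : ∀ r s, 2 * (x r ⬝ᵥ x s) ∈ Set.Icc (-2 : ℝ) 2 := by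
    intro r s
    have hr := hone r
    have hs := hone s
    simp only [dotProduct, Fin.sum_univ_three] at hr hs ⊢
    constructor
    · nlinarith [sq_nonneg (x r 0 + x s 0), sq_nonneg (x r 1 + x s 1), sq_nonneg (x r 2 + x s 2)]
    · nlinarith [sq_nonneg (x r 0 - x s 0), sq_nonneg (x r 1 - x s 1), sq_nonneg (x r 2 - x s 2)]
  refine ⟨fun r s _ => ⟨_, hmem r s, (hreal r s).symm⟩, fun r s t _ _ _ => ?_⟩
  have htriple : D.triple ε r s t = (((2 * (x r ⬝ᵥ x s)) ^ 2 + (2 * (x r ⬝ᵥ x t)) ^ 2 +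
      (2 * (x s ⬝ᵥ x t)) ^ 2 - 2 * (x r ⬝ᵥ x s) * (2 * (x r ⬝ᵥ x t)) * (2 * (x s ⬝ᵥ x t)) - 2 :
      ℝ) : ℂ) := by
    rw [triple, hreal, hreal, hreal]
    push_cast
    ring
  have hlow := sq_add_sq_add_sq_sub_mul_nonneg (x := 2 * (x r ⬝ᵥ x s))
    (y := 2 * (x r ⬝ᵥ x t)) (hmem s t)
  refine ⟨_, ⟨by linarith, ?_⟩, htriple.symm⟩
  have hdet : (of fun i j => ((x (![r, s, t] i) j : ℝ) : ℂ)).det =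
      (((of fun i => x (![r, s, t] i)).det : ℝ) : ℂ) :=
    (RingHom.map_det Complex.ofRealHom _).symm
  rw [triple_eq, hU.minor_eq, hdet] at htriple
  generalize (of fun i => x (![r, s, t] i)).det = δ at htriple
  norm_cast at htriple
  rw [← htriple]
  linarith [sq_nonneg δ]

end KnotDiagram

/-! ### The explicit representation in `SU(2)`. -/

/-- The coordinates of the trace-free matrix `P⁻¹ (T A) P`. -/
theorem matrixP_inv_mul_matrixT_mul {β : ℂ} (hβ : β ≠ 0) (e G b : ℂ) :
    (matrixP β)⁻¹ * (matrixT β * !![e / 2 - Complex.I * G, b; -(β ^ 2 * b),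
      e - (e / 2 - Complex.I * G)]) * matrixP β = traceFreeMatrix ![e / 2, G, -(β * b)] := by
  have hP : IsUnit (matrixP β).det := by
    rw [isUnit_iff_ne_zero, matrixP, det_fin_two_of]
    have := inv_ne_zero hβ
    intro h
    apply this
    linear_combination -h / 2
  have h : (matrixT β * !![e / 2 - Complex.I * G, b; -(β ^ 2 * b),
      e - (e / 2 - Complex.I * G)]) * matrixP β =
      matrixP β * traceFreeMatrix ![e / 2, G, -(β * b)] := by
    ext i j
    fin_cases i <;> fin_cases j <;>
      simp [matrixP, matrixT, traceFreeMatrix, mul_apply] <;> field_simp <;> ring_nf <;>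
      simp only [Complex.I_sq] <;> ring
  rw [Matrix.mul_assoc, h, ← Matrix.mul_assoc, nonsing_inv_mul _ hP, Matrix.one_mul]

/-- The roots of `d² - x d + 1` for `|x| < 2`. -/
theorem exists_real_of_root {x : ℝ} (hx : x ∈ Set.Ioo (-2 : ℝ) 2) {d : ℂ}
    (hd : d ^ 2 - x * d + 1 = 0) :
    ∃ τ : ℝ, τ ^ 2 = 4 - x ^ 2 ∧ τ ≠ 0 ∧ (x : ℂ) - 2 * d = Complex.I * τ := by
  have hpos : 0 < 4 - x ^ 2 := by nlinarith [hx.1, hx.2]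
  set t := Real.sqrt (4 - x ^ 2)
  have ht : t ^ 2 = 4 - x ^ 2 := Real.sq_sqrt hpos.le
  have ht0 : t ≠ 0 := (Real.sqrt_pos.2 hpos).ne'
  have htc : (t : ℂ) ^ 2 = 4 - x ^ 2 := by exact_mod_cast ht
  -- `x - 2d` is a square root of the discriminant `x² - 4 < 0`, hence purely imaginary.
  have h : ((x : ℂ) - 2 * d) ^ 2 = (Complex.I * t) ^ 2 := by
    rw [mul_pow, Complex.I_sq, htc]
    linear_combination 4 * hd
  rcases sq_eq_sq_iff_eq_or_eq_neg.1 h with h | h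
  · exact ⟨t, ht, ht0, h⟩
  · exact ⟨-t, by rw [neg_sq, ht], neg_ne_zero.2 ht0, by rw [h]; push_cast; ring⟩

namespace KnotDiagram

variable {D : KnotDiagram} {ε : D.PairCoords}

theorem IsElliptic.exists_real (h : D.IsElliptic ε) :
    ∃ e : D.Arc → D.Arc → ℝ, ∀ r s, D.cordMatrix ε r s = e r s := by
  have : ∀ r s, ∃ y : ℝ, D.cordMatrix ε r s = y := by
    intro r s
    by_cases hrs : r = s
    · exact ⟨2, by rw [hrs, cordMatrix_self]; norm_num⟩
    · obtain ⟨y, -, hy⟩ := h.1 r s hrs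
      exact ⟨y, hy.symm⟩
  choose e he using this
  exact ⟨e, he⟩

theorem injective_of_minor_ne_zero {a : Fin 3 → D.Arc} (ha : D.minor ε a ≠ 0) :
    Function.Injective a := by
  intro i j hij
  by_contra hne
  exact ha (det_zero_of_row_eq hne (by ext k; simp [hij]))

theorem IsElliptic.exists_isGoodTriple (h : D.IsElliptic ε) {a : Fin 3 → D.Arc}
    (ha : D.minor ε a ≠ 0) : D.IsGoodTriple ε (a 0) (a 1) (a 2) := by
  have hinj := injective_of_minor_ne_zero ha
  have h01 : a 0 ≠ a 1 := hinj.ne (by decide)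
  have h02 : a 0 ≠ a 2 := hinj.ne (by decide)
  have h12 : a 1 ≠ a 2 := hinj.ne (by decide)
  obtain ⟨x, hx, hxe⟩ := h.1 _ _ h01
  obtain ⟨y, -, hye⟩ := h.1 _ _ h02
  obtain ⟨z, -, hze⟩ := h.1 _ _ h12
  obtain ⟨t, ht, hte⟩ := h.2 _ _ _ h01 h02 h12
  have ht2 : t ≠ 2 := by
    rintro rfl
    apply ha
    have h3 := triple_eq ε (a 0) (a 1) (a 2)
    have h4 : ![a 0, a 1, a 2] = a := by
      ext i
      fin_cases i <;> rfl
    rw [h4, ← hte] at h3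
    push_cast at h3
    linear_combination 2 * h3
  have htlt : t < 2 := lt_of_le_of_ne ht.2 ht2
  have hxyz : t = x ^ 2 + y ^ 2 + z ^ 2 - x * y * z - 2 := by
    rw [triple, ← hxe, ← hye, ← hze] at hte
    exact_mod_cast hte
  refine ⟨⟨x, ⟨lt_of_le_of_ne hx.1 ?_, lt_of_le_of_ne hx.2 ?_⟩, hxe⟩, t, htlt, hte⟩
  -- At `x = ∓2` the triple equals `2 + (y ± z)²`, which is not below 2.
  · rintro rfl
    nlinarith [sq_nonneg (y + z)]
  · rintro rfl
    nlinarith [sq_nonneg (y - z)]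

theorem IsGoodTriple.minor_ne_zero {p q r : D.Arc} (h : D.IsGoodTriple ε p q r) :
    D.minor ε ![p, q, r] ≠ 0 := by
  obtain ⟨-, t, ht, hte⟩ := h
  intro h0
  rw [triple_eq, h0, zero_div, sub_zero] at hte
  have : t = 2 := by exact_mod_cast hte
  exact (Set.mem_Iio.1 ht).ne this

/-- The explicit vector model for a good triple `p, q, r`. -/
theorem IsGoodTriple.exists_explicit (hrank : D.augRank ε = 3) (hell : D.IsElliptic ε)
    {p q r : D.Arc} (hgood : D.IsGoodTriple ε p q r) {d : ℂ}
    (hd : d ^ 2 - D.cordMatrix ε p q * d + 1 = 0) :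
    ∃ (α : ℝ) (e G b : D.Arc → ℝ), 0 < α ∧ D.alpha ε p q r d = α ∧
      D.IsTraceFamily ε p q r d (fun l => !![(e l : ℂ) / 2 - Complex.I * G l, (b l : ℂ);
        -(α * b l), (e l : ℂ) - ((e l : ℂ) / 2 - Complex.I * G l)]) ∧
      ∀ β : ℝ, β ^ 2 = α →
        IsVectorModel ε fun l i => ((![e l / 2, G l, -(β * b l)] i : ℝ) : ℂ) := by
  obtain ⟨e, he⟩ := hell.exists_real
  have hsymm : ∀ r s, e r s = e s r := fun r s => by
    have := cordMatrix_comm ε r s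
    rw [he, he] at this
    exact_mod_cast this
  have hself : ∀ r, e r r = 2 := fun r => by
    have := cordMatrix_self ε r
    rw [he] at this
    exact_mod_cast this
  have hminor := hgood.minor_ne_zero
  obtain ⟨⟨x, hx, hxe⟩, t, ht, hte⟩ := hgood
  have hx' : x = e p q := by rw [he] at hxe; exact_mod_cast hxe
  rw [← hxe] at hd
  obtain ⟨τ, hτ, hτ0, hdτ⟩ := exists_real_of_root hx hd
  have hτc : (τ : ℂ) ≠ 0 := by exact_mod_cast hτ0
  -- Gram–Schmidt with `u_p = (1, 0, 0)` and `u_q = (x/2, τ/2, 0)`: `G l` is the second coordinate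
  -- of `u_l`, read off from its product with `u_q`.
  obtain ⟨G, hGτ⟩ : ∃ G : D.Arc → ℝ, ∀ l, G l * τ = e q l - e p l * x / 2 :=
    ⟨fun l => (e q l - e p l * x / 2) / τ, fun l => div_mul_cancel₀ _ hτ0⟩
  -- The square of the third coordinate of `u_r`.
  obtain ⟨α, hα⟩ : ∃ α : ℝ, α = 1 - e p r ^ 2 / 4 - G r ^ 2 := ⟨_, rfl⟩
  have haEntry : ∀ l, D.aEntry ε p q d l = (e p l : ℂ) / 2 - Complex.I * G l := by
    intro l
    have hdd : d = (x - Complex.I * τ) / 2 := by linear_combination -hdτ / 2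
    have hGc : (G l : ℂ) * τ = e q l - e p l * x / 2 := by exact_mod_cast hGτ l
    rw [aEntry, he, he, ← hxe, hdτ, div_eq_iff (mul_ne_zero Complex.I_ne_zero hτc), hdd]
    linear_combination -hGc + (G l : ℂ) * τ * Complex.I_sq
  have hαpos : 0 < α := by
    have h1 : α * τ ^ 2 = 2 - t := by
      have h2 : t = e p q ^ 2 + e p r ^ 2 + e q r ^ 2 - e p q * e p r * e q r - 2 := by
        rw [triple, he, he, he] at hte
        exact_mod_cast hte
      have h3 : α * τ ^ 2 = (1 - e p r ^ 2 / 4) * τ ^ 2 - (G r * τ) ^ 2 := by rw [hα]; ring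
      rw [h3, hGτ, hτ, h2, hx']
      ring
    have h2 : 0 < τ ^ 2 := by positivity
    have h3 : 0 < α * τ ^ 2 := by rw [h1]; exact sub_pos.2 ht
    exact pos_of_mul_pos_left h3 h2.le
  -- Solves `2 u_r·u_l = ε_rl` for the third coordinate `-β b_l`, with `b_r = 1`.
  obtain ⟨b, hbα⟩ : ∃ b : D.Arc → ℝ,
      ∀ l, 2 * α * b l = -(2 * G r * G l + e p r * e p l / 2 - e r l) :=
    ⟨fun l => -(2 * G r * G l + e p r * e p l / 2 - e r l) / (2 * α),
      fun l => mul_div_cancel₀ _ (by positivity)⟩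
  have hαeq : D.alpha ε p q r d = α := by
    rw [alpha, haEntry, he, hα]
    push_cast
    linear_combination (G r : ℂ) ^ 2 * Complex.I_sq
  have hmodel : ∀ β : ℝ, β ^ 2 = α →
      IsVectorModel ε fun l i => ((![e p l / 2, G l, -(β * b l)] i : ℝ) : ℂ) := by
    intro β hβ
    have hGp : G p = 0 := by
      apply mul_right_cancel₀ hτ0
      rw [hGτ, hself, hsymm q p, ← hx']
      ring
    have hGq : G q = τ / 2 := by
      apply mul_right_cancel₀ hτ0
      rw [hGτ, hself, ← hx']
      linear_combination -hτ / 2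
    have hbp : b p = 0 := by
      apply mul_left_cancel₀ (by positivity : 2 * α ≠ 0)
      rw [hbα, hGp, hself, hsymm r p]
      ring
    have hbq : b q = 0 := by
      apply mul_left_cancel₀ (by positivity : 2 * α ≠ 0)
      rw [hbα, hGq, ← hx', hsymm r q]
      linear_combination -hGτ r
    have hbr : b r = 1 := by
      apply mul_left_cancel₀ (by positivity : 2 * α ≠ 0)
      rw [hbα, hself, hα]
      ring
    refine isVectorModel_of_forall hrank hminor fun l i => ?_
    rw [he]
    suffices hreal : e l (![p, q, r] i) = 2 * (![e p l / 2, G l, -(β * b l)] ⬝ᵥ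
        ![e p (![p, q, r] i) / 2, G (![p, q, r] i), -(β * b (![p, q, r] i))]) by
      rw [hreal]
      simp [dotProduct, Fin.sum_univ_three]
    simp only [dotProduct, Fin.sum_univ_three, cons_val_zero, cons_val_one, cons_val]
    fin_cases i
    · simp only [Fin.zero_eta, cons_val_zero, hGp, hbp, hself, hsymm l p]
      ring
    · simp only [Fin.mk_one, cons_val_one, cons_val_zero, hGq, hbq, hsymm l q, ← hx']
      linear_combination -hGτ l
    · simp only [Fin.reduceFinMk, cons_val, hbr, hsymm l r]
      linear_combination -hbα l - 2 * b l * hβ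
  refine ⟨α, e p, G, b, hαpos, hαeq, fun l => ⟨(haEntry l).symm, ?_, ?_, ?_⟩, hmodel⟩
  · rw [haEntry, he]
    rfl
  · have hbc : 2 * (α : ℂ) * b l = -(2 * G r * G l + e p r * e p l / 2 - e r l) := by
      exact_mod_cast hbα l
    have hαc : (α : ℂ) = 1 - (e p r : ℂ) ^ 2 / 4 - (G r : ℂ) ^ 2 := by
      rw [hα]
      push_cast
      ring
    simp only [haEntry, he, of_apply, cons_val', cons_val_zero, cons_val_one, cons_val_fin_one]
    linear_combination -hbc + (b l : ℂ) * hαc +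
      (2 * (G r : ℂ) * G l - b l * (G r : ℂ) ^ 2) * Complex.I_sq
  -- The determinant of `A_l` is the squared length `e²/4 + G² + α b²` of its vector.
  · have hs : Real.sqrt α ^ 2 = α := Real.sq_sqrt hαpos.le
    have hsc : ((Real.sqrt α : ℝ) : ℂ) ^ 2 = α := by exact_mod_cast hs
    have hone := (hmodel _ hs).dotProduct_self l
    simp [dotProduct, Fin.sum_univ_three] at hone
    rw [det_fin_two_of]
    linear_combination hone - (b l : ℂ) ^ 2 * hsc - (G l : ℂ) ^ 2 * Complex.I_sq

/-- The explicit representation in `SU(2)` with character `𝔛(ε)`. -/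
theorem IsFrakX.exists_explicit_hom {a : Fin 3 → D.Arc} {σ : ℂ} {χ : D.KnotGroup → ℂ}
    (hχ : D.IsFrakX ε a σ χ) (hε : ε ∈ D.augVariety) (hrank : D.augRank ε = 3)
    (ha : D.minor ε a ≠ 0) (hσ : σ ^ 2 = D.minor ε a / 2) (hell : D.IsElliptic ε)
    {p q r : D.Arc} (hgood : D.IsGoodTriple ε p q r) {d : ℂ}
    (hd : d ^ 2 - D.cordMatrix ε p q * d + 1 = 0) :
    ∃ (A : D.Arc → Matrix (Fin 2) (Fin 2) ℂ) (β : ℂ)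
      (ρ : D.KnotGroup →* Matrix.specialUnitaryGroup (Fin 2) ℂ),
      D.IsTraceFamily ε p q r d A ∧ β ^ 2 = D.alpha ε p q r d ∧
      (∀ l, (ρ (D.meridian l) : Matrix (Fin 2) (Fin 2) ℂ) =
        (matrixP β)⁻¹ * (matrixT β * A l) * matrixP β) ∧
      D.IsCharacterOf χ ρ := by
  obtain ⟨α, e, G, b, hα, hαeq, hA, hmodel⟩ := hgood.exists_explicit hrank hell hd
  -- The sign of `β` reflects the third coordinate, so it can be chosen to match `σ`.
  have hor : ∃ β : ℝ, β ^ 2 = α ∧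
      2 * (of fun i j => ((![e (a i) / 2, G (a i), -(β * b (a i))] j : ℝ) : ℂ)).det = σ := by
    have hs : Real.sqrt α ^ 2 = α := Real.sq_sqrt hα.le
    rcases (hmodel _ hs).det_eq_or hσ with h | h
    · exact ⟨_, hs, h⟩
    · refine ⟨-Real.sqrt α, by rw [neg_sq, hs], ?_⟩
      rw [det_fin_three] at h ⊢
      simp at h ⊢
      linear_combination -h
  obtain ⟨β, hβ, hdet⟩ := hor
  have hU := hmodel β hβ
  obtain ⟨ρ, hρ⟩ := hU.exists_hom hε ha (specialUnitaryGroup (Fin 2) ℂ).subtype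
    Subtype.val_injective
    (fun l => ⟨_, traceFreeMatrix_mem_specialUnitaryGroup _ (hU.dotProduct_self l)⟩)
    (fun l => rfl)
  have hρ' : ∀ l, (ρ (D.meridian l) : Matrix (Fin 2) (Fin 2) ℂ) =
      traceFreeMatrix fun i => ((![e l / 2, G l, -(β * b l)] i : ℝ) : ℂ) :=
    fun l => by rw [hρ]
  have hβ0 : (β : ℂ) ≠ 0 := by
    intro h
    have : β = 0 := by exact_mod_cast h
    rw [this] at hβ
    norm_num at hβ
    exact hα.ne hβ
  refine ⟨_, β, ρ, hA, by rw [hαeq, ← hβ]; push_cast; rfl, fun l => ?_,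
    hχ.eq_trace ha hU hdet (ψ := (specialUnitaryGroup (Fin 2) ℂ).subtype.comp ρ) hρ'⟩
  have hαc : (α : ℂ) = (β : ℂ) ^ 2 := by exact_mod_cast hβ.symm
  rw [hρ', hαc, matrixP_inv_mul_matrixT_mul hβ0]
  congr 1
  ext i
  fin_cases i <;> simp

end KnotDiagram

end

theorem mainTheorem3 (D : KnotDiagram) (ε : D.PairCoords) (hε : ε ∈ D.augVariety)
    (hrank : D.augRank ε = 3) :
    -- the choices on which the trace-free character `𝔛(ε)` depends can be made
    (∃ a : Fin 3 → D.Arc, D.minor ε a ≠ 0) ∧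
    -- for all such choices, `𝔛(ε)` exists and is unique ...
    ∀ (a : Fin 3 → D.Arc) (σ : ℂ), D.minor ε a ≠ 0 → σ ^ 2 = D.minor ε a / 2 →
      ∃ χ : D.KnotGroup → ℂ, D.IsFrakX ε a σ χ ∧ (∀ χ', D.IsFrakX ε a σ χ' → χ' = χ) ∧
        -- ... it is not binary-dihedral, and it is an `SU(2)` character iff `ε` is elliptic
        ¬ D.IsBinaryDihedralCharacter χ ∧
        (D.IsElliptic ε ↔ D.IsSU2Character χ) ∧
        -- the `SU(2)` representation is the explicit conjugate `m_l ↦ P⁻¹ (T A_l) P`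
        (D.IsElliptic ε →
          (∃ p q r : D.Arc, D.IsGoodTriple ε p q r) ∧
          ∀ (p q r : D.Arc) (d : ℂ), D.IsGoodTriple ε p q r →
            d ^ 2 - D.cordMatrix ε p q * d + 1 = 0 →
            ∃ (A : D.Arc → Matrix (Fin 2) (Fin 2) ℂ) (β : ℂ)
              (ρ : D.KnotGroup →* Matrix.specialUnitaryGroup (Fin 2) ℂ),
              D.IsTraceFamily ε p q r d A ∧ β ^ 2 = D.alpha ε p q r d ∧
              (∀ l, (ρ (D.meridian l) : Matrix (Fin 2) (Fin 2) ℂ) =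
                (matrixP β)⁻¹ * (matrixT β * A l) * matrixP β) ∧
              D.IsCharacterOf χ ρ) := by
  refine ⟨(KnotDiagram.cordMatrix_isSymm ε).exists_det_submatrix_ne_zero hrank,
    fun a σ ha hσ => ?_⟩
  obtain ⟨χ, hχ⟩ := KnotDiagram.exists_isFrakX hε hrank ha hσ
  have hexplicit := fun (hell : D.IsElliptic ε) (p q r : D.Arc) (d : ℂ)
    (hgood : D.IsGoodTriple ε p q r) (hd : d ^ 2 - D.cordMatrix ε p q * d + 1 = 0) =>
      hχ.exists_explicit_hom hε hrank ha hσ hell hgood hd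
  refine ⟨χ, hχ, fun χ' hχ' => hχ.unique ha hχ', hχ.not_isBinaryDihedralCharacter hε ha,
    ⟨fun hell => ?_, fun ⟨ρ, hρ⟩ => ?_⟩,
    fun hell => ⟨⟨_, _, _, hell.exists_isGoodTriple ha⟩, hexplicit hell⟩⟩
  · obtain ⟨d, hd⟩ : ∃ d : ℂ, d ^ 2 - D.cordMatrix ε (a 0) (a 1) * d + 1 = 0 := by
      obtain ⟨s, hs⟩ := IsAlgClosed.exists_pow_nat_eq (D.cordMatrix ε (a 0) (a 1) ^ 2 - 4) two_pos
      exact ⟨(D.cordMatrix ε (a 0) (a 1) + s) / 2, by linear_combination hs / 4⟩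
    obtain ⟨-, -, ρ, -, -, -, hρ⟩ := hexplicit hell _ _ _ d (hell.exists_isGoodTriple ha) hd
    exact ⟨ρ, hρ⟩
  · obtain ⟨x, hx, -⟩ := hχ.exists_real_model hρ
    exact hx.isElliptic
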